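/- Let $f:\mathbb R^n\to\mathbb R^n$ be continuously differentiable with $f(0)=0$ and $f(x)\neq 0$ for all $x\neq 0$, let $\alpha\in(0,1)$ and $\beta<0$, and put $$c=\left(\frac{2-\beta}{2-\alpha}\right)^{\frac1{p-q}},\qquad p=\frac{2-2\alpha}{2-\alpha},\quad q=\frac{2-2\beta}{2-\beta}.$$ Assume that $f$ is a gradient field, i.e. $f=-\nabla V$ for some $V:\mathbb R^n\to\mathbb R$, and that $\int_0^x f(y)^T\,dy\to-\infty$ as $\|x\|\to\infty$ (Euclidean norm). Let $H(x)=-\tfrac12\left(\nabla f(x)+\nabla f(x)^T\right)$ and assume that one of the following holds: (i) there is $\lambda_0>0$ such that, for every $x\neq 0$, $H(x)$ is positive definite with minimum eigenvalue at least $\lambda_0$; or (ii) $H(x)$ is positive semidefinite for every $x\neq 0$; the multiplicity of $0$ as an eigenvalue of $H(x)$ (possibly $0$) is the same for all $x\in\mathbb R^n$; for every $x\in\mathbb R^n$, $f(x)$ is orthogonal to the eigenspace of $H(x)$ for the eigenvalue $0$; and there is $\lambda_0>0$ such that, for every $x\in\mathbb R^n$, every positive eigenvalue of $H(x)$ is at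 least $\lambda_0$. Consider the system $$\dot x=\begin{cases} c\,\dfrac{f(x)}{\|f(x)\|^{\alpha}}, & x\neq0,\ \|f(x)\|\le 1,\\[2mm] c\,\dfrac{f(x)}{\|f(x)\|^{\beta}}, & \|f(x)\|>1,\\[1mm] 0,& x=0.\end{cases}$$ Then for each initial condition this system has a unique solution on $[0,\infty)$, and the origin is a fixed-time stable equilibrium: it is Lyapunov stable, and there are a function $T:\mathbb R^n\to[0,\infty)$ and a constant $T_{\max}<\infty$ such that $T(x_0)\le T_{\max}$ for all $x_0\in\mathbb R^n$ and, for each $x_0$, the solution with $x(0)=x_0$ satisfies $x(t)\to0$ as $t\to T(x_0)$ and $x(t)=0$ for all $t\ge T(x_0)$. -/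

import Mathlib

open Filter Topology Set

noncomputable section

/-- Points of `ℝⁿ` with the Euclidean norm. -/
abbrev Eucl (n : ℕ) : Type := EuclideanSpace ℝ (Fin n)

/-! ### Stability notions for `ẋ = g(x)` -/

/-- `x` is a solution of `ẋ = g(x)` on `[0, ∞)` with `x(0) = x₀` (one-sided derivative at `0`). -/
def IsSolution {n : ℕ} (g : Eucl n → Eucl n) (x₀ : Eucl n) (x : ℝ → Eucl n) : Prop :=
  x 0 = x₀ ∧ IsIntegralCurveOn x (fun _ => g) (Ici 0)

/-- For every initial condition there is a solution for all `t ≥ 0`, and it is unique there. -/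
def HasUniqueSolutions {n : ℕ} (g : Eucl n → Eucl n) : Prop :=
  ∀ x₀ : Eucl n, (∃ x, IsSolution g x₀ x) ∧
    ∀ x y, IsSolution g x₀ x → IsSolution g x₀ y → EqOn x y (Ici 0)

/-- Lyapunov stability of the origin. -/
def LyapunovStable {n : ℕ} (g : Eucl n → Eucl n) : Prop :=
  ∀ ε > 0, ∃ δ > 0, ∀ x₀ x, IsSolution g x₀ x → ‖x₀‖ < δ → ∀ t ≥ 0, ‖x t‖ < ε

/-- `T` is a (finite) settling-time function: the solution from `x₀` tends to the origin as
`t → T x₀` and stays at the origin from then on. -/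
def IsSettlingTime {n : ℕ} (g : Eucl n → Eucl n) (T : Eucl n → ℝ) : Prop :=
  (∀ x₀, 0 ≤ T x₀) ∧ ∀ x₀ x, IsSolution g x₀ x →
    Tendsto x (𝓝[Ici 0] (T x₀)) (𝓝 0) ∧ ∀ t ≥ T x₀, x t = 0

/-- The origin is a fixed-time stable equilibrium of `ẋ = g(x)`: an equilibrium that is Lyapunov
stable and has a settling-time function (that is, it is finite-time stable), where the
settling-time function is bounded over all initial conditions. -/
def FixedTimeStable {n : ℕ} (g : Eucl n → Eucl n) : Prop :=
  g 0 = 0 ∧ LyapunovStable g ∧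
    ∃ T : Eucl n → ℝ, IsSettlingTime g T ∧ ∃ Tmax : ℝ, ∀ x₀, T x₀ ≤ Tmax

/-! ### The vector field, its Jacobian, and the modified dynamics -/

/-- `f` is a gradient field: `∇V = -f` for some scalar function `V`. -/
def IsGradientField {n : ℕ} (f : Eucl n → Eucl n) : Prop :=
  ∃ V : Eucl n → ℝ, ∀ x, HasGradientAt V (-f x) x

/-- The line integral `∫₀ˣ f(y)ᵀ dy`, along the segment from `0` to `x` (for a continuous gradient
field the integral does not depend on the path). -/
def lineIntegral {n : ℕ} (f : Eucl n → Eucl n) (x : Eucl n) : ℝ :=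
  ∫ᶜ y in Path.segment 0 x, innerSL ℝ (f y)

/-- The Jacobian matrix `∇f(x)`, with entries `∂fᵢ/∂xⱼ`. -/
def jacobianMatrix {n : ℕ} (f : Eucl n → Eucl n) (x : Eucl n) : Matrix (Fin n) (Fin n) ℝ :=
  Matrix.of fun i j => fderiv ℝ f x (EuclideanSpace.single j 1) i

/-- `H(x) = -½ (∇f(x) + ∇f(x)ᵀ)`. -/
def matrixH {n : ℕ} (f : Eucl n → Eucl n) (x : Eucl n) : Matrix (Fin n) (Fin n) ℝ :=
  -((1 / 2 : ℝ) • (jacobianMatrix f x + (jacobianMatrix f x).transpose))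

/-- `μ` is an eigenvalue of the real matrix `A`. -/
def IsEigenvalue {n : ℕ} (A : Matrix (Fin n) (Fin n) ℝ) (μ : ℝ) : Prop :=
  Module.End.HasEigenvalue (Matrix.toEuclideanLin A) μ

/-- The eigenspace of `A` for the eigenvalue `0` (trivial if `0` is not an eigenvalue). -/
def zeroEigenspace {n : ℕ} (A : Matrix (Fin n) (Fin n) ℝ) : Submodule ℝ (Eucl n) :=
  Module.End.eigenspace (Matrix.toEuclideanLin A) 0

/-- Condition (i): away from the origin `H` is positive definite, with its minimum eigenvalue
bounded below by a constant `l > 0`. -/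
def ConditionI {n : ℕ} (H : Eucl n → Matrix (Fin n) (Fin n) ℝ) : Prop :=
  ∃ l > 0, ∀ x, x ≠ 0 → (H x).PosDef ∧ ∀ μ, IsEigenvalue (H x) μ → l ≤ μ

/-- Condition (ii): away from the origin `H` is positive semidefinite, the multiplicity of the
eigenvalue `0` is constant, `f` is orthogonal to the eigenspace of `H` for the eigenvalue `0`, and
the smallest positive eigenvalue of `H` (the one that follows `0`) is bounded below by a
constant `l > 0`. -/
def ConditionII {n : ℕ} (f : Eucl n → Eucl n) (H : Eucl n → Matrix (Fin n) (Fin n) ℝ) : Prop :=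
  (∀ x, x ≠ 0 → (H x).PosSemidef) ∧
  (∃ m : ℕ, ∀ x, Module.finrank ℝ (zeroEigenspace (H x)) = m) ∧
  (∀ x, ∀ v ∈ zeroEigenspace (H x), inner ℝ (f x) v = 0) ∧
  ∃ l > 0, ∀ x, ∀ μ, IsEigenvalue (H x) μ → 0 < μ → l ≤ μ

/-- The constant `c = ((2 - β) / (2 - α)) ^ (1 / (p - q))` with `p = (2 - 2α) / (2 - α)` and
`q = (2 - 2β) / (2 - β)`. -/
def gain (α β : ℝ) : ℝ :=
  ((2 - β) / (2 - α)) ^ (1 / ((2 - 2 * α) / (2 - α) - (2 - 2 * β) / (2 - β)))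

open Classical in
/-- The right-hand side of the piecewise-normalized dynamics. -/
def piecewiseField {n : ℕ} (f : Eucl n → Eucl n) (α β c : ℝ) (x : Eucl n) : Eucl n :=
  if x = 0 then 0
  else if ‖f x‖ ≤ 1 then (c / ‖f x‖ ^ α) • f x
  else (c / ‖f x‖ ^ β) • f x

end

/-! Along a curve with velocity `k f(x)`, `k ≥ 0`, the derivative of `‖f(x)‖²` is `-2k⟪f, H f⟫`.
Either spectral condition bounds it by `-2kl‖f‖²`, since `f` has no component in the kernel of `H`
(`exists_inner_fderiv_le`). So `r = ‖f(x)‖` is a Lyapunov function; for the modified field `k = c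
max(r^{-α}, r^{-β})`, hence `r' ≤ -lc max(r^{1-α}, r^{1-β})` while `r > 0`. The `β` term brings `r`
from any value down to 1 in bounded time, and the `α` term brings it from 1 to 0
(`eq_zero_of_settling_le`).

Well-posedness is delicate only at the origin, the sole zero of `f`. Between a level `ε > 0` and the
initial value of `r`, the field agrees with a bounded locally Lipschitz one, and monotonicity of `r`
keeps trajectories in that range until they reach level `ε`. This gives uniqueness up to the arrival
at the origin, which is absorbing because `r` cannot grow. Existence follows by letting `ε → 0`
(`exists_hasDerivWithinAt_piecewiseField`). -/

/-! ### Dissipation from the spectrum of `H`. -/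

/-- A symmetric operator is bounded below by `l` at `v` if each of its eigenvectors is either
orthogonal to `v` or belongs to an eigenvalue at least `l`. -/
theorem LinearMap.IsSymmetric.mul_sq_norm_le_inner {E : Type*} [NormedAddCommGroup E]
    [InnerProductSpace ℝ E] [FiniteDimensional ℝ E] {T : E →ₗ[ℝ] E} (hT : T.IsSymmetric)
    {l : ℝ} {v : E}
    (h : ∀ μ w, Module.End.HasEigenvector T μ w → l ≤ μ ∨ inner ℝ v w = 0) :
    l * ‖v‖ ^ 2 ≤ inner ℝ v (T v) := by
  set b := hT.eigenvectorBasis rfl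
  have h1 : ‖v‖ ^ 2 = ∑ i, inner ℝ v (b i) * inner ℝ v (b i) := by
    rw [← real_inner_self_eq_norm_sq, ← b.sum_inner_mul_inner v v]
    exact Finset.sum_congr rfl fun i _ => by rw [real_inner_comm v (b i)]
  have h2 : inner ℝ v (T v) =
      ∑ i, hT.eigenvalues rfl i * (inner ℝ v (b i) * inner ℝ v (b i)) := by
    rw [← b.sum_inner_mul_inner v (T v)]
    refine Finset.sum_congr rfl fun i _ => ?_
    rw [← hT (b i) v, hT.apply_eigenvectorBasis rfl i, real_inner_smul_left,
      real_inner_comm v (b i)]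
    simp only [RCLike.ofReal_real_eq_id, id_eq]
    ring
  rw [h1, h2, Finset.mul_sum]
  refine Finset.sum_le_sum fun i _ => ?_
  rcases h _ _ (hT.hasEigenvector_eigenvectorBasis rfl i) with hi | hi
  · exact mul_le_mul_of_nonneg_right hi (mul_self_nonneg _)
  · change inner ℝ v (b i) = 0 at hi
    simp [hi]

theorem toEuclideanLin_jacobianMatrix {n : ℕ} (f : Eucl n → Eucl n) (x v : Eucl n) :
    Matrix.toEuclideanLin (jacobianMatrix f x) v = fderiv ℝ f x v := by
  have hv : v = ∑ j, v j • EuclideanSpace.single j (1 : ℝ) := by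
    ext i; simp [Finset.sum_apply, Pi.single_apply]
  conv_rhs => rw [hv]
  ext i
  simp [Matrix.toLpLin_apply, Matrix.mulVec, dotProduct, jacobianMatrix, mul_comm]

/-- A quadratic form does not see the antisymmetric part of its matrix. -/
theorem inner_toEuclideanLin_matrixH {n : ℕ} (f : Eucl n → Eucl n) (x v : Eucl n) :
    inner ℝ v (Matrix.toEuclideanLin (matrixH f x) v) = -inner ℝ v (fderiv ℝ f x v) := by
  have hT : inner ℝ v (Matrix.toEuclideanLin (jacobianMatrix f x).transpose v) =
      inner ℝ v (fderiv ℝ f x v) := by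
    rw [← Matrix.conjTranspose_eq_transpose_of_trivial,
      Matrix.toEuclideanLin_conjTranspose_eq_adjoint, LinearMap.adjoint_inner_right,
      toEuclideanLin_jacobianMatrix, real_inner_comm]
  simp only [matrixH, map_neg, map_smul, map_add, LinearMap.neg_apply, LinearMap.smul_apply,
    LinearMap.add_apply, inner_neg_right, inner_smul_right, inner_add_right, hT,
    toEuclideanLin_jacobianMatrix]
  ring

theorem isSymmetric_toEuclideanLin_matrixH {n : ℕ} (f : Eucl n → Eucl n) (x : Eucl n) :
    (Matrix.toEuclideanLin (matrixH f x)).IsSymmetric := by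
  rw [Matrix.isSymmetric_toEuclideanLin_iff, Matrix.IsHermitian,
    Matrix.conjTranspose_eq_transpose_of_trivial]
  simp [matrixH, Matrix.transpose_smul, add_comm]

/-- Either spectral condition makes `‖f‖` dissipate at a uniform rate in the direction `f`. -/
theorem exists_inner_fderiv_le {n : ℕ} {f : Eucl n → Eucl n} (hf0 : f 0 = 0)
    (hH : ConditionI (matrixH f) ∨ ConditionII f (matrixH f)) :
    ∃ l > 0, ∀ x, inner ℝ (f x) (fderiv ℝ f x (f x)) ≤ -l * ‖f x‖ ^ 2 := by
  suffices h : ∃ l > 0, ∀ x, x ≠ 0 → ∀ μ w,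
      Module.End.HasEigenvector (Matrix.toEuclideanLin (matrixH f x)) μ w →
        l ≤ μ ∨ inner ℝ (f x) w = 0 by
    obtain ⟨l, hl, h⟩ := h
    refine ⟨l, hl, fun x => ?_⟩
    rcases eq_or_ne x 0 with rfl | hx
    · simp [hf0]
    · have := (isSymmetric_toEuclideanLin_matrixH f x).mul_sq_norm_le_inner (h x hx)
      rw [inner_toEuclideanLin_matrixH] at this
      linarith
  rcases hH with ⟨l, hl, h⟩ | ⟨hpos, -, horth, l, hl, h⟩
  · exact ⟨l, hl, fun x hx μ w hw => .inl ((h x hx).2 μ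
      (Module.End.hasEigenvalue_of_hasEigenvector hw))⟩
  · refine ⟨l, hl, fun x hx μ w hw => ?_⟩
    have hμ := Module.End.hasEigenvalue_of_hasEigenvector hw
    have hμ0 : 0 ≤ μ := eigenvalue_nonneg_of_nonneg hμ fun v =>
      (Matrix.isPositive_toEuclideanLin_iff.2 (hpos x hx)).re_inner_nonneg_right v
    rcases hμ0.eq_or_lt with rfl | hlt
    · exact .inr (horth x w hw.1)
    · exact .inl (h x μ hμ hlt)

/-! ### The scalar speed profile. -/

/-- The scalar factor `c max(r^{-α}, r^{-β})` of the piecewise-normalized dynamics. -/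
noncomputable def speedFactor (α β c r : ℝ) : ℝ := c * max (r ^ (-α)) (r ^ (-β))

/-- The norm `c max(r^{1-α}, r^{1-β})` of the piecewise-normalized field where `‖f‖ = r`. -/
noncomputable def speed (α β c r : ℝ) : ℝ := c * max (r ^ (1 - α)) (r ^ (1 - β))

section Speed

variable {α β c : ℝ}

theorem speedFactor_nonneg (hc : 0 < c) {r : ℝ} (hr : 0 ≤ r) : 0 ≤ speedFactor α β c r :=
  mul_nonneg hc.le ((Real.rpow_nonneg hr _).trans (le_max_left _ _))

theorem speed_nonneg (hc : 0 < c) {r : ℝ} (hr : 0 ≤ r) : 0 ≤ speed α β c r :=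
  mul_nonneg hc.le ((Real.rpow_nonneg hr _).trans (le_max_left _ _))

theorem speed_zero (hα : α < 1) (hβ : β < 0) : speed α β c 0 = 0 := by
  rw [speed, Real.zero_rpow (by linarith), Real.zero_rpow (by linarith)]; simp

theorem speedFactor_mul_self (hα : α < 1) (hβ : β < 0) {r : ℝ} (hr : 0 ≤ r) :
    speedFactor α β c r * r = speed α β c r := by
  rcases hr.eq_or_lt with rfl | hr
  · simp [speed_zero hα hβ]
  · rw [speedFactor, speed, mul_assoc, max_mul_of_nonneg _ _ hr.le, ← Real.rpow_add_one hr.ne',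
      ← Real.rpow_add_one hr.ne', neg_add_eq_sub, neg_add_eq_sub]

theorem speed_mono (hc : 0 < c) (hα : α < 1) (hβ : β < 0) {r s : ℝ} (hr : 0 ≤ r) (hrs : r ≤ s) :
    speed α β c r ≤ speed α β c s :=
  mul_le_mul_of_nonneg_left (max_le_max (Real.rpow_le_rpow hr hrs (by linarith))
    (Real.rpow_le_rpow hr hrs (by linarith))) hc.le

theorem continuous_speed (hα : α < 1) (hβ : β < 0) : Continuous (speed α β c) := by
  unfold speed
  exact continuous_const.mul ((Real.continuous_rpow_const (by linarith)).max
    (Real.continuous_rpow_const (by linarith)))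

theorem continuousAt_speedFactor {r : ℝ} (hr : 0 < r) : ContinuousAt (speedFactor α β c) r := by
  unfold speedFactor
  exact continuousAt_const.mul ((Real.continuousAt_rpow_const _ _ (.inl hr.ne')).max
    (Real.continuousAt_rpow_const _ _ (.inl hr.ne')))

end Speed

/-! ### The piecewise field and its Lipschitz regularization. -/

section Field

variable {n : ℕ} {f : Eucl n → Eucl n} {α β c : ℝ}

/-- Since `β < α`, the maximum selects the branch: `r^{-α}` dominates for `0 < r ≤ 1`, `r^{-β}` for
`r > 1`. -/
theorem piecewiseField_eq_smul (hα : 0 < α) (hβ : β < 0) (hf0 : f 0 = 0) (x : Eucl n) :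
    piecewiseField f α β c x = speedFactor α β c ‖f x‖ • f x := by
  unfold piecewiseField speedFactor
  split_ifs with h0 h1
  · simp [h0, hf0]
  · rcases eq_or_ne (f x) 0 with h | h
    · simp [h]
    have hr : 0 < ‖f x‖ := norm_pos_iff.2 h
    rw [max_eq_left (Real.rpow_le_rpow_of_exponent_ge hr h1 (by linarith)),
      Real.rpow_neg hr.le, div_eq_mul_inv]
  · push Not at h1
    rw [max_eq_right (Real.rpow_le_rpow_of_exponent_le h1.le (by linarith)),
      Real.rpow_neg (norm_nonneg _), div_eq_mul_inv]

theorem norm_piecewiseField (hc : 0 < c) (hα : 0 < α ∧ α < 1) (hβ : β < 0) (hf0 : f 0 = 0)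
    (x : Eucl n) : ‖piecewiseField f α β c x‖ = speed α β c ‖f x‖ := by
  rw [piecewiseField_eq_smul hα.1 hβ hf0, norm_smul, Real.norm_eq_abs,
    abs_of_nonneg (speedFactor_nonneg hc (norm_nonneg _)),
    speedFactor_mul_self hα.2 hβ (norm_nonneg _)]

/-- Where `f` vanishes the scalar factor may blow up, but the norm of the product is `speed`, which
tends to 0 because `1 - α > 0`. -/
theorem continuous_piecewiseField (hc : 0 < c) (hα : 0 < α ∧ α < 1) (hβ : β < 0)
    (hf : Continuous f) (hf0 : f 0 = 0) : Continuous (piecewiseField f α β c) := by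
  refine continuous_iff_continuousAt.2 fun x => ?_
  rcases eq_or_ne (f x) 0 with h | h
  · have hx : piecewiseField f α β c x = 0 := by
      rw [piecewiseField_eq_smul hα.1 hβ hf0, h, smul_zero]
    rw [ContinuousAt, hx, tendsto_zero_iff_norm_tendsto_zero]
    simp_rw [norm_piecewiseField hc hα hβ hf0]
    have := ((continuous_speed (c := c) hα.2 hβ).comp hf.norm).tendsto x
    simpa [h, speed_zero hα.2 hβ, Function.comp_def] using this
  · rw [show piecewiseField f α β c = fun x => speedFactor α β c ‖f x‖ • f x from
      funext (piecewiseField_eq_smul hα.1 hβ hf0)]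
    exact (ContinuousAt.comp (f := fun x => ‖f x‖) (continuousAt_speedFactor (norm_pos_iff.2 h))
      hf.norm.continuousAt).smul hf.continuousAt

/-- A field of norm at most `M` that is regular where `f` is small, and agrees with the
piecewise-normalized field where `ε ≤ ‖f‖` and the latter has norm at most `M`. -/
noncomputable def regularizedField (f : Eucl n → Eucl n) (α β c ε M : ℝ) (x : Eucl n) : Eucl n :=
  min (speedFactor α β c (max ‖f x‖ ε)) (M / max ‖f x‖ ε) • f x

theorem regularizedFactor_nonneg (hc : 0 < c) {ε M : ℝ} (hM : 0 ≤ M) (x : Eucl n) :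
    0 ≤ min (speedFactor α β c (max ‖f x‖ ε)) (M / max ‖f x‖ ε) :=
  have h : 0 ≤ max ‖f x‖ ε := (norm_nonneg _).trans (le_max_left _ _)
  le_min (speedFactor_nonneg hc h) (div_nonneg hM h)

theorem norm_regularizedField_le (hc : 0 < c) {ε M : ℝ} (hε : 0 < ε) (hM : 0 ≤ M) (x : Eucl n) :
    ‖regularizedField f α β c ε M x‖ ≤ M := by
  have hm : 0 < max ‖f x‖ ε := hε.trans_le (le_max_right _ _)
  rw [regularizedField, norm_smul, Real.norm_eq_abs,
    abs_of_nonneg (regularizedFactor_nonneg hc hM x)]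
  calc _ ≤ M / max ‖f x‖ ε * max ‖f x‖ ε := by
        gcongr
        exacts [min_le_right _ _, le_max_left _ _]
    _ = M := div_mul_cancel₀ _ hm.ne'

theorem norm_regularizedField_le_speed (hc : 0 < c) (hα : α < 1) (hβ : β < 0) {ε M : ℝ}
    (hε : 0 < ε) (hM : 0 ≤ M) {x : Eucl n} (hx : ‖f x‖ ≤ ε) :
    ‖regularizedField f α β c ε M x‖ ≤ speed α β c ε := by
  rw [regularizedField, norm_smul, Real.norm_eq_abs,
    abs_of_nonneg (regularizedFactor_nonneg hc hM x), max_eq_right hx,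
    ← speedFactor_mul_self hα hβ hε.le]
  gcongr
  exacts [speedFactor_nonneg hc hε.le, min_le_left _ _]

/-- The cap `M = speed r` is inactive at levels up to `r` because `speed` is monotone. -/
theorem regularizedField_eq (hc : 0 < c) (hα : 0 < α ∧ α < 1) (hβ : β < 0) (hf0 : f 0 = 0)
    {ε r : ℝ} (hε : 0 < ε) {x : Eucl n} (hx : ε ≤ ‖f x‖) (hxr : ‖f x‖ ≤ r) :
    regularizedField f α β c ε (speed α β c r) x = piecewiseField f α β c x := by
  rw [regularizedField, piecewiseField_eq_smul hα.1 hβ hf0, max_eq_left hx, min_eq_left]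
  rw [le_div_iff₀ (hε.trans_le hx), speedFactor_mul_self hα.2 hβ (norm_nonneg _)]
  exact speed_mono hc hα.2 hβ (norm_nonneg _) hxr

theorem LocallyLipschitz.smul_of_normed {X E : Type*} [PseudoEMetricSpace X]
    [NormedAddCommGroup E] [NormedSpace ℝ E] {a : X → ℝ} {v : X → E}
    (ha : LocallyLipschitz a) (hv : LocallyLipschitz v) :
    LocallyLipschitz fun x => a x • v x :=
  (ContDiff.locallyLipschitz (𝕂 := ℝ) (f := fun p : ℝ × E => p.1 • p.2)
    (contDiff_fst.smul contDiff_snd)).comp (ha.prodMk hv)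

/-- The truncation keeps the argument at least `ε`, away from a singularity of `φ` at 0. -/
theorem locallyLipschitz_comp_max {φ : ℝ → ℝ} {ε : ℝ} (hε : 0 < ε)
    (hφ : ∀ r, 0 < r → ContDiffAt ℝ 1 φ r) : LocallyLipschitz fun r => φ (max r ε) := by
  intro r
  have hm : LipschitzWith 1 fun r : ℝ => max r ε := LipschitzWith.id.max_const ε
  obtain ⟨K, t, ht, hK⟩ :=
    (hφ (max r ε) (hε.trans_le (le_max_right _ _))).exists_lipschitzOnWith
  exact ⟨K * 1, _, hm.continuous.continuousAt ht,
    hK.comp hm.lipschitzOnWith (mapsTo_preimage _ _)⟩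

theorem locallyLipschitz_norm_comp {X E : Type*} [PseudoEMetricSpace X]
    [NormedAddCommGroup E] {v : X → E}
    (hv : LocallyLipschitz v) : LocallyLipschitz fun x => ‖v x‖ :=
  lipschitzWith_one_norm.locallyLipschitz.comp hv

theorem locallyLipschitz_regularizedField (hc : 0 < c) (hf : ContDiff ℝ 1 f) {ε M : ℝ} (hε : 0 < ε) :
    LocallyLipschitz (regularizedField f α β c ε M) := by
  have hn := locallyLipschitz_norm_comp hf.locallyLipschitz
  have hpow : ∀ a : ℝ, LocallyLipschitz fun r : ℝ => c * (max r ε) ^ a := fun a =>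
    locallyLipschitz_comp_max (φ := fun r => c * r ^ a) hε
      fun r hr => contDiffAt_const.mul (Real.contDiffAt_rpow_const_of_ne hr.ne')
  have hdiv : LocallyLipschitz fun r : ℝ => M / max r ε :=
    locallyLipschitz_comp_max (φ := fun r => M / r) hε
      fun r hr => contDiffAt_const.div contDiffAt_id hr.ne'
  have hmin := ((((hpow (-α)).max (hpow (-β))).min hdiv).comp hn).smul_of_normed
    hf.locallyLipschitz
  have heq : regularizedField f α β c ε M = fun x => min (max (c * max ‖f x‖ ε ^ (-α))
      (c * max ‖f x‖ ε ^ (-β))) (M / max ‖f x‖ ε) • f x := by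
    funext x
    rw [regularizedField, speedFactor, mul_max_of_nonneg _ _ hc.le]
  rw [heq]
  exact hmin

end Field

/-! ### Decay of `‖f‖` along trajectories and the uniform settling bound. -/

section Dissipation

variable {n : ℕ} {f : Eucl n → Eucl n} {α β c l T : ℝ} {x : ℝ → Eucl n}

theorem hasDerivWithinAt_sq_norm_comp (hf : ContDiff ℝ 1 f) {s : Set ℝ} {t : ℝ}
    {v : Eucl n} (hx : HasDerivWithinAt x v s t) :
    HasDerivWithinAt (fun τ => ‖f (x τ)‖ ^ 2) (2 * inner ℝ (f (x t)) (fderiv ℝ f (x t) v)) s t :=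
  (((hf.differentiable one_ne_zero) (x t)).hasFDerivAt.comp_hasDerivWithinAt t hx).norm_sq

/-- `‖f‖` is nonincreasing along curves that move in the direction `f`. -/
theorem antitoneOn_norm_comp (hf : ContDiff ℝ 1 f) (hl : 0 < l)
    (hdiss : ∀ x, inner ℝ (f x) (fderiv ℝ f x (f x)) ≤ -l * ‖f x‖ ^ 2)
    {k : ℝ → ℝ} (hk : ∀ t, 0 ≤ k t) {s : Set ℝ} (hs : Convex ℝ s)
    (hx : ∀ t ∈ s, HasDerivWithinAt x (k t • f (x t)) s t) :
    AntitoneOn (fun t => ‖f (x t)‖) s := by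
  have h : AntitoneOn (fun t => ‖f (x t)‖ ^ 2) s := by
    have hd := fun t ht => hasDerivWithinAt_sq_norm_comp hf (hx t ht)
    refine antitoneOn_of_hasDerivWithinAt_nonpos hs (fun t ht => (hd t ht).continuousWithinAt)
      (fun t ht => (hd t (interior_subset ht)).mono interior_subset) fun t _ => ?_
    rw [map_smul, inner_smul_right]
    have := mul_le_mul_of_nonneg_left (hdiss (x t)) (hk t)
    have : 0 ≤ k t * (l * ‖f (x t)‖ ^ 2) := mul_nonneg (hk t) (by positivity)
    linarith
  exact fun a ha b hb hab => (sq_le_sq₀ (norm_nonneg _) (norm_nonneg _)).1 (h ha hb hab)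

theorem antitoneOn_norm_comp_piecewiseField (hf : ContDiff ℝ 1 f) (hf0 : f 0 = 0) (hl : 0 < l)
    (hdiss : ∀ x, inner ℝ (f x) (fderiv ℝ f x (f x)) ≤ -l * ‖f x‖ ^ 2)
    (hc : 0 < c) (hα : 0 < α) (hβ : β < 0) {s : Set ℝ} (hs : Convex ℝ s)
    (hx : ∀ t ∈ s, HasDerivWithinAt x (piecewiseField f α β c (x t)) s t) :
    AntitoneOn (fun t => ‖f (x t)‖) s :=
  antitoneOn_norm_comp hf hl hdiss
    (fun t => speedFactor_nonneg hc (norm_nonneg (f (x t)))) hs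
    fun t ht => piecewiseField_eq_smul hα hβ hf0 (x t) ▸ hx t ht

/-- For `γ = α` or `γ = β`, the power `‖f‖ ^ γ` evolves at least at a constant rate as long as
`f` does not vanish. -/
theorem antitoneOn_rpow_norm_comp (hf : ContDiff ℝ 1 f) (hf0 : f 0 = 0) (hl : 0 < l)
    (hdiss : ∀ x, inner ℝ (f x) (fderiv ℝ f x (f x)) ≤ -l * ‖f x‖ ^ 2)
    (hc : 0 < c) (hα : 0 < α) (hβ : β < 0) {s : Set ℝ} (hs : Convex ℝ s)
    (hx : ∀ t ∈ s, HasDerivWithinAt x (piecewiseField f α β c (x t)) s t)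
    (hne : ∀ t ∈ s, f (x t) ≠ 0) {γ : ℝ} (hγ : γ = α ∨ γ = β) :
    AntitoneOn (fun t => γ * ‖f (x t)‖ ^ γ + γ ^ 2 * l * c * t) s := by
  have hd : ∀ t ∈ s, HasDerivWithinAt (fun t => γ * (‖f (x t)‖ ^ 2) ^ (γ / 2) + γ ^ 2 * l * c * t)
      (γ * (2 * inner ℝ (f (x t)) (fderiv ℝ f (x t) (piecewiseField f α β c (x t))) * (γ / 2) *
        (‖f (x t)‖ ^ 2) ^ (γ / 2 - 1)) + γ ^ 2 * l * c * 1) s t := fun t ht =>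
    (((hasDerivWithinAt_sq_norm_comp hf (hx t ht)).rpow_const
      (.inl (pow_ne_zero 2 (norm_ne_zero_iff.2 (hne t ht))))).const_mul γ).add
      ((hasDerivWithinAt_id t s).const_mul _)
  -- `‖f‖ ^ γ` is differentiated as a power of the differentiable function `‖f‖ ^ 2`.
  have hfun : (fun t => γ * ‖f (x t)‖ ^ γ + γ ^ 2 * l * c * t) =
      fun t => γ * (‖f (x t)‖ ^ 2) ^ (γ / 2) + γ ^ 2 * l * c * t := by
    funext t
    rw [← Real.rpow_natCast_mul (norm_nonneg _)]
    norm_num [mul_div_cancel₀]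
  rw [hfun]
  refine antitoneOn_of_hasDerivWithinAt_nonpos hs (fun t ht => (hd t ht).continuousWithinAt)
    (fun t ht => (hd t (interior_subset ht)).mono interior_subset) fun t ht => ?_
  have hr : 0 < ‖f (x t)‖ := norm_pos_iff.2 (hne t (interior_subset ht))
  rw [piecewiseField_eq_smul hα hβ hf0, map_smul, inner_smul_right]
  set r := ‖f (x t)‖
  set D : ℝ := inner ℝ (f (x t)) (fderiv ℝ f (x t) (f (x t)))
  have hpow : (r ^ 2) ^ (γ / 2 - 1) * (r ^ (-γ) * r ^ 2) = 1 := by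
    rw [← Real.rpow_natCast_mul hr.le, ← Real.rpow_natCast r 2, ← Real.rpow_add hr,
      ← Real.rpow_add hr]
    norm_num
    ring_nf
    exact Real.rpow_zero r
  -- Only the term of the maximum whose exponent matches `γ` is kept; all powers of `r` then cancel
  -- through `hpow`.
  have hfac : c * r ^ (-γ) ≤ speedFactor α β c r := by
    unfold speedFactor
    rcases hγ with rfl | rfl
    · gcongr; exact le_max_left _ _
    · gcongr; exact le_max_right _ _
  have h1 : speedFactor α β c r * D ≤ c * r ^ (-γ) * (-l * r ^ 2) := by
    calc _ ≤ speedFactor α β c r * (-l * r ^ 2) :=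
          mul_le_mul_of_nonneg_left (hdiss (x t)) (speedFactor_nonneg hc hr.le)
      _ ≤ _ := mul_le_mul_of_nonpos_right hfac (by nlinarith [sq_nonneg r])
  have hP : 0 ≤ γ ^ 2 * (r ^ 2) ^ (γ / 2 - 1) := by positivity
  have h2 := mul_le_mul_of_nonneg_left h1 hP
  have h3 : γ ^ 2 * (r ^ 2) ^ (γ / 2 - 1) * (c * r ^ (-γ) * (-l * r ^ 2)) = -(γ ^ 2 * l * c) := by
    linear_combination -(γ ^ 2 * l * c) * hpow
  linarith

/-- Trajectories of the piecewise-normalized dynamics reach the zero set of `f` within a time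
that does not depend on the initial condition. -/
theorem eq_zero_of_settling_le (hf : ContDiff ℝ 1 f) (hf0 : f 0 = 0) (hl : 0 < l)
    (hdiss : ∀ x, inner ℝ (f x) (fderiv ℝ f x (f x)) ≤ -l * ‖f x‖ ^ 2)
    (hc : 0 < c) (hα : 0 < α) (hβ : β < 0)
    (hx : ∀ t ∈ Icc 0 T, HasDerivWithinAt x (piecewiseField f α β c (x t)) (Icc 0 T) t)
    (hT : 1 / (-β * l * c) + 1 / (α * l * c) ≤ T) : f (x T) = 0 := by
  by_contra hne
  have hβ' : 0 < -β := neg_pos.2 hβ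
  set T₁ := 1 / (-β * l * c) with hT₁
  set T₂ := 1 / (α * l * c) with hT₂
  have h₁ : 0 < T₁ := by positivity
  have h₂ : 0 < T₂ := by positivity
  have hmT : T ∈ Icc 0 T := ⟨by linarith, le_rfl⟩
  have hanti := antitoneOn_norm_comp_piecewiseField hf hf0 hl hdiss hc hα hβ (convex_Icc 0 T) hx
  have hpos : ∀ t ∈ Icc 0 T, 0 < ‖f (x t)‖ := fun t ht =>
    (norm_pos_iff.2 hne).trans_le (hanti ht hmT ht.2)
  have hmono := fun γ hγ => antitoneOn_rpow_norm_comp hf hf0 hl hdiss hc hα hβ (convex_Icc 0 T) hx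
    (fun t ht => norm_pos_iff.1 (hpos t ht)) (γ := γ) hγ
  have hm0 : (0 : ℝ) ∈ Icc 0 T := ⟨le_rfl, by linarith⟩
  have hm1 : T₁ ∈ Icc 0 T := ⟨h₁.le, by linarith⟩
  -- The power `‖f‖ ^ β` gains at least 1 on `[0, T₁]` from a positive value, so it exceeds 1 at
  -- `T₁`, which forces `‖f‖ < 1` there.
  have hle : ‖f (x T₁)‖ ≤ 1 := by
    by_contra! hgt
    have h := hmono β (.inr rfl) hm0 hm1 h₁.le
    have hB : β ^ 2 * l * c * T₁ = -β := by rw [hT₁]; field_simp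
    have hw : ‖f (x T₁)‖ ^ β < 1 := Real.rpow_lt_one_of_one_lt_of_neg hgt hβ
    have hw0 : 0 < ‖f (x 0)‖ ^ β := Real.rpow_pos_of_pos (hpos 0 hm0) _
    simp only at h
    nlinarith
  -- On `[T₁, T]` the power `‖f‖ ^ α` loses at least 1 from a value at most 1, so it cannot stay
  -- positive.
  have h := hmono α (.inl rfl) hm1 hmT hm1.2
  have hA : α ^ 2 * l * c * T₂ = α := by rw [hT₂]; field_simp
  have hw : ‖f (x T₁)‖ ^ α ≤ 1 := Real.rpow_le_one (norm_nonneg _) hle hα.le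
  have hw0 : 0 < α * ‖f (x T)‖ ^ α := mul_pos hα (Real.rpow_pos_of_pos (hpos T hmT) _)
  have hk : 0 < α ^ 2 * l * c := by positivity
  have : α ^ 2 * l * c * (T₁ + T₂) ≤ α ^ 2 * l * c * T := mul_le_mul_of_nonneg_left hT hk.le
  have := mul_le_mul_of_nonneg_left hw hα.le
  simp only at h
  linarith

end Dissipation

/-! ### Autonomous equations with locally Lipschitz right-hand side. -/

section AutonomousODE

variable {E : Type*} [NormedAddCommGroup E] [NormedSpace ℝ E] {F : E → E} {x y : ℝ → E} {M T : ℝ}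

/-- Both trajectories have compact image, and on the union of the images a single Lipschitz constant
works. -/
theorem LocallyLipschitz.eqOn_Icc_of_hasDerivWithinAt (hF : LocallyLipschitz F)
    (hx : ∀ t ∈ Icc 0 T, HasDerivWithinAt x (F (x t)) (Icc 0 T) t)
    (hy : ∀ t ∈ Icc 0 T, HasDerivWithinAt y (F (y t)) (Icc 0 T) t)
    (h0 : x 0 = y 0) : EqOn x y (Icc 0 T) := by
  have hxc : ContinuousOn x (Icc 0 T) := fun t ht => (hx t ht).continuousWithinAt
  have hyc : ContinuousOn y (Icc 0 T) := fun t ht => (hy t ht).continuousWithinAt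
  obtain ⟨K, hK⟩ := (hF.locallyLipschitzOn (s := x '' Icc 0 T ∪ y '' Icc 0 T)
    ).exists_lipschitzOnWith_of_compact
      ((isCompact_Icc.image_of_continuousOn hxc).union (isCompact_Icc.image_of_continuousOn hyc))
  have hmem : ∀ t ∈ Ico 0 T, t ∈ Icc 0 T := fun t ht => Ico_subset_Icc_self ht
  exact ODE_solution_unique_of_mem_Icc_right (fun _ _ => hK) hxc
    (fun t ht => (hx t (hmem t ht)).mono_of_mem_nhdsWithin (Icc_mem_nhdsGE_of_mem ht))
    (fun t ht => .inl (mem_image_of_mem x (hmem t ht))) hyc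
    (fun t ht => (hy t (hmem t ht)).mono_of_mem_nhdsWithin (Icc_mem_nhdsGE_of_mem ht))
    (fun t ht => .inr (mem_image_of_mem y (hmem t ht))) h0

/-- A bounded locally Lipschitz field on a proper space has solutions on every compact interval. -/
theorem LocallyLipschitz.exists_hasDerivWithinAt_Icc [ProperSpace E] [CompleteSpace E]
    (hF : LocallyLipschitz F)
    (hM : ∀ x, ‖F x‖ ≤ M) (hT : 0 ≤ T) (x₀ : E) :
    ∃ x : ℝ → E, x 0 = x₀ ∧ ∀ t ∈ Icc 0 T, HasDerivWithinAt x (F (x t)) (Icc 0 T) t := by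
  have hM0 : 0 ≤ M := (norm_nonneg _).trans (hM 0)
  lift M to NNReal using hM0
  lift T to NNReal using hT
  -- At speed at most `M` the curve stays in this ball up to time `T`, so Picard–Lindelöf applies on
  -- the whole interval.
  obtain ⟨K, hK⟩ := (hF.locallyLipschitzOn (s := Metric.closedBall x₀ (M * T : NNReal))
    ).exists_lipschitzOnWith_of_compact (isCompact_closedBall _ _)
  have hP : IsPicardLindelof (fun _ => F) (⟨0, le_rfl, T.2⟩ : Icc (0 : ℝ) T) x₀ (M * T) 0 M K :=
    .of_time_independent (fun x _ => hM x) hK (by simp)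
  exact hP.exists_eq_forall_mem_Icc_hasDerivWithinAt₀

end AutonomousODE

/-! ### Uniqueness for the piecewise dynamics. -/

section Solutions

variable {n : ℕ} {f : Eucl n → Eucl n} {α β c l T : ℝ} {x y : ℝ → Eucl n}

/-- Monotonicity of `‖f‖` confines both curves to levels between `ε` and the initial one, where the
field agrees with a locally Lipschitz regularization. -/
theorem eqOn_of_ne_zero (hf : ContDiff ℝ 1 f) (hf0 : f 0 = 0) (hl : 0 < l)
    (hdiss : ∀ x, inner ℝ (f x) (fderiv ℝ f x (f x)) ≤ -l * ‖f x‖ ^ 2)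
    (hc : 0 < c) (hα : 0 < α ∧ α < 1) (hβ : β < 0)
    (hx : ∀ t ∈ Icc 0 T, HasDerivWithinAt x (piecewiseField f α β c (x t)) (Icc 0 T) t)
    (hy : ∀ t ∈ Icc 0 T, HasDerivWithinAt y (piecewiseField f α β c (y t)) (Icc 0 T) t)
    (h0 : x 0 = y 0) (hT : 0 ≤ T) (hxT : f (x T) ≠ 0) (hyT : f (y T) ≠ 0) :
    EqOn x y (Icc 0 T) := by
  set ε := min ‖f (x T)‖ ‖f (y T)‖
  have hε : 0 < ε := lt_min (norm_pos_iff.2 hxT) (norm_pos_iff.2 hyT)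
  have hxa := antitoneOn_norm_comp_piecewiseField hf hf0 hl hdiss hc hα.1 hβ (convex_Icc 0 T) hx
  have hya := antitoneOn_norm_comp_piecewiseField hf hf0 hl hdiss hc hα.1 hβ (convex_Icc 0 T) hy
  have hm0 : (0 : ℝ) ∈ Icc 0 T := ⟨le_rfl, hT⟩
  have hmT : T ∈ Icc 0 T := ⟨hT, le_rfl⟩
  refine (locallyLipschitz_regularizedField (α := α) (β := β) (M := speed α β c ‖f (x 0)‖)
    hc hf hε).eqOn_Icc_of_hasDerivWithinAt (fun t ht => ?_) (fun t ht => ?_) h0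
  · rw [regularizedField_eq hc hα hβ hf0 hε ((min_le_left _ _).trans (hxa ht hmT ht.2))
      (hxa hm0 ht ht.1)]
    exact hx t ht
  · rw [regularizedField_eq hc hα hβ hf0 hε ((min_le_right _ _).trans (hya ht hmT ht.2))
      (h0 ▸ hya hm0 ht ht.1)]
    exact hy t ht

theorem eq_zero_of_eq_zero (hf : ContDiff ℝ 1 f) (hf0 : f 0 = 0) (hfne : ∀ x, x ≠ 0 → f x ≠ 0)
    (hl : 0 < l) (hdiss : ∀ x, inner ℝ (f x) (fderiv ℝ f x (f x)) ≤ -l * ‖f x‖ ^ 2)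
    (hc : 0 < c) (hα : 0 < α) (hβ : β < 0) {s : Set ℝ} (hs : Convex ℝ s)
    (hx : ∀ t ∈ s, HasDerivWithinAt x (piecewiseField f α β c (x t)) s t)
    {a b : ℝ} (ha : a ∈ s) (hb : b ∈ s) (hab : a ≤ b) (h : x a = 0) : x b = 0 := by
  by_contra hne
  have := antitoneOn_norm_comp_piecewiseField hf hf0 hl hdiss hc hα hβ hs hx ha hb hab
  simp only [h, hf0, norm_zero] at this
  exact hfne _ hne (norm_le_zero_iff.1 this)

/-- Up to the first zero `τ` of `x` the curves agree by `eqOn_of_ne_zero`; continuity then gives `y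
τ = 0`, and the origin is absorbing. -/
theorem eq_zero_of_other_eq_zero (hf : ContDiff ℝ 1 f) (hf0 : f 0 = 0)
    (hfne : ∀ x, x ≠ 0 → f x ≠ 0)
    (hl : 0 < l) (hdiss : ∀ x, inner ℝ (f x) (fderiv ℝ f x (f x)) ≤ -l * ‖f x‖ ^ 2)
    (hc : 0 < c) (hα : 0 < α ∧ α < 1) (hβ : β < 0)
    (hx : ∀ t ∈ Icc 0 T, HasDerivWithinAt x (piecewiseField f α β c (x t)) (Icc 0 T) t)
    (hy : ∀ t ∈ Icc 0 T, HasDerivWithinAt y (piecewiseField f α β c (y t)) (Icc 0 T) t)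
    (h0 : x 0 = y 0) (hT : 0 ≤ T) (hxT : x T = 0) : y T = 0 := by
  by_contra hyT
  have hxc : ContinuousOn x (Icc 0 T) := fun t ht => (hx t ht).continuousWithinAt
  have hyc : ContinuousOn y (Icc 0 T) := fun t ht => (hy t ht).continuousWithinAt
  have hyne : ∀ t ∈ Icc 0 T, y t ≠ 0 := fun t ht h => hyT <|
    eq_zero_of_eq_zero hf hf0 hfne hl hdiss hc hα.1 hβ (convex_Icc 0 T) hy ht ⟨hT, le_rfl⟩ ht.2 h
  set Z := Icc 0 T ∩ x ⁻¹' {0}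
  have hZ : IsCompact Z := isCompact_Icc.of_isClosed_subset
    (hxc.preimage_isClosed_of_isClosed isClosed_Icc isClosed_singleton) inter_subset_left
  obtain ⟨τ, hτ, hmin⟩ := hZ.exists_isLeast ⟨T, ⟨hT, le_rfl⟩, hxT⟩
  have hlt : ∀ t ∈ Ico 0 τ, x t = y t := fun t ht => by
    have hsub : Icc 0 t ⊆ Icc 0 T := Icc_subset_Icc_right (ht.2.le.trans hτ.1.2)
    have htT : t ∈ Icc 0 T := hsub ⟨ht.1, le_rfl⟩
    refine eqOn_of_ne_zero hf hf0 hl hdiss hc hα hβ (fun s hs => (hx s (hsub hs)).mono hsub)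
      (fun s hs => (hy s (hsub hs)).mono hsub) h0 ht.1 (hfne _ fun h => ?_)
      (hfne _ (hyne t htT)) ⟨ht.1, le_rfl⟩
    exact ht.2.not_ge (hmin ⟨htT, h⟩)
  refine hyne τ hτ.1 ?_
  rcases hτ.1.1.eq_or_lt with h | hpos
  · rw [← h, ← h0, h]; exact hτ.2
  have hsub : Ico 0 τ ⊆ Icc 0 T := fun t ht => ⟨ht.1, ht.2.le.trans hτ.1.2⟩
  have hne : (𝓝[Ico 0 τ] τ).NeBot := by
    rw [← mem_closure_iff_nhdsWithin_neBot, closure_Ico hpos.ne]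
    exact ⟨hpos.le, le_rfl⟩
  have h1 : Tendsto y (𝓝[Ico 0 τ] τ) (𝓝 (x τ)) :=
    ((hxc τ hτ.1).mono hsub).tendsto.congr' (eventually_mem_nhdsWithin.mono hlt)
  exact (tendsto_nhds_unique ((hyc τ hτ.1).mono hsub).tendsto h1).trans hτ.2

theorem eq_of_hasDerivWithinAt_piecewiseField (hf : ContDiff ℝ 1 f) (hf0 : f 0 = 0)
    (hfne : ∀ x, x ≠ 0 → f x ≠ 0)
    (hl : 0 < l) (hdiss : ∀ x, inner ℝ (f x) (fderiv ℝ f x (f x)) ≤ -l * ‖f x‖ ^ 2)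
    (hc : 0 < c) (hα : 0 < α ∧ α < 1) (hβ : β < 0)
    (hx : ∀ t ∈ Icc 0 T, HasDerivWithinAt x (piecewiseField f α β c (x t)) (Icc 0 T) t)
    (hy : ∀ t ∈ Icc 0 T, HasDerivWithinAt y (piecewiseField f α β c (y t)) (Icc 0 T) t)
    (h0 : x 0 = y 0) (hT : 0 ≤ T) : x T = y T := by
  by_cases hxT : x T = 0
  · rw [hxT, eq_zero_of_other_eq_zero hf hf0 hfne hl hdiss hc hα hβ hx hy h0 hT hxT]
  by_cases hyT : y T = 0
  · rw [hyT, eq_zero_of_other_eq_zero hf hf0 hfne hl hdiss hc hα hβ hy hx h0.symm hT hyT]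
  exact eqOn_of_ne_zero hf hf0 hl hdiss hc hα hβ hx hy h0 hT (hfne _ hxT) (hfne _ hyT)
    ⟨hT, le_rfl⟩

end Solutions

/-! ### Existence by passing to the limit in the regularization. -/

theorem IsCompact.tendsto_of_tendsto_comp {X Y ι : Type*} [TopologicalSpace X] [TopologicalSpace Y]
    [T2Space Y] {K : Set X} (hK : IsCompact K) {g : X → Y} (hg : Continuous g) {p : X}
    (hp : ∀ x, g x = g p → x = p) {u : ι → X} {L : Filter ι} (hu : ∀ i, u i ∈ K)
    (h : Tendsto (g ∘ u) L (𝓝 (g p))) : Tendsto u L (𝓝 p) := by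
  refine hK.tendsto_nhds_of_unique_mapClusterPt (.of_forall hu) fun x _ hx => hp x ?_
  have hc := hx.continuousAt_comp hg.continuousAt
  by_contra hne
  have := (disjoint_nhds_nhds.2 hne).mono_right h
  exact (hc.neBot.ne this.eq_bot)

section Existence

variable {E : Type*} [NormedAddCommGroup E] [NormedSpace ℝ E] [CompleteSpace E]

/-- A pointwise limit of integral curves whose velocities are bounded and converge pointwise is an
integral curve of the limit field. -/
theorem hasDerivWithinAt_of_tendsto {F : ℕ → E → E} {g : E → E} {X : ℕ → ℝ → E} {x : ℝ → E}
    {M T : ℝ} (hF : ∀ k, Continuous (F k)) (hM : ∀ k y, ‖F k y‖ ≤ M) (hg : Continuous g)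
    (hX : ∀ k, ∀ t ∈ Icc 0 T, HasDerivWithinAt (X k) (F k (X k t)) (Icc 0 T) t)
    (hx : ∀ t ∈ Icc 0 T, Tendsto (fun k => X k t) atTop (𝓝 (x t)))
    (hgx : ∀ t ∈ Icc 0 T, Tendsto (fun k => F k (X k t)) atTop (𝓝 (g (x t)))) :
    ∀ t ∈ Icc 0 T, HasDerivWithinAt x (g (x t)) (Icc 0 T) t := by
  have hXc : ∀ k, ContinuousOn (X k) (Icc 0 T) := fun k t ht => (hX k t ht).continuousWithinAt
  have hFc : ∀ k, ContinuousOn (fun t => F k (X k t)) (Icc 0 T) := fun k =>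
    (hF k).comp_continuousOn (hXc k)
  have hM0 : 0 ≤ M := (norm_nonneg _).trans (hM 0 0)
  -- The integral equation passes to the limit by dominated convergence, with the constant `M` as
  -- majorant.
  have hint : ∀ t ∈ Icc 0 T, x t = ODE.picard (fun _ => g) 0 (x 0) x t := fun t ht => by
    have hsub : Icc 0 t ⊆ Icc 0 T := Icc_subset_Icc_right ht.2
    have h0 : (0 : ℝ) ∈ Icc 0 T := ⟨le_rfl, ht.1.trans ht.2⟩
    have hk : ∀ k, ∫ s in (0 : ℝ)..t, F k (X k s) = X k t - X k 0 := fun k => by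
      refine intervalIntegral.integral_eq_sub_of_hasDeriv_right_of_le ht.1 ((hXc k).mono hsub)
        (fun s hs => ?_) (((hFc k).mono hsub).intervalIntegrable_of_Icc ht.1)
      exact (hX k s (hsub (Ioo_subset_Icc_self hs))).mono_of_mem_nhdsWithin
        (Icc_mem_nhdsGT_of_mem ⟨hs.1.le, hs.2.trans_le ht.2⟩)
    have hlim : Tendsto (fun k => ∫ s in (0 : ℝ)..t, F k (X k s)) atTop
        (𝓝 (∫ s in (0 : ℝ)..t, g (x s))) := by
      have hmem : ∀ s ∈ uIoc 0 t, s ∈ Icc 0 T := fun s hs => by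
        rw [uIoc_of_le ht.1] at hs
        exact hsub (Ioc_subset_Icc_self hs)
      refine intervalIntegral.tendsto_integral_filter_of_dominated_convergence (fun _ => M)
        (.of_forall fun k => ?_) (.of_forall fun k => .of_forall fun s _ => hM k _)
        intervalIntegrable_const (.of_forall fun s hs => hgx s (hmem s hs))
      exact ((hFc k).mono hmem).aestronglyMeasurable measurableSet_uIoc
    have := tendsto_nhds_unique hlim (((hx t ht).sub (hx 0 h0)).congr fun k => (hk k).symm)
    rw [ODE.picard_apply, this]
    abel
  -- The limit inherits the Lipschitz constant `M`; its continuity is what allows the integral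
  -- equation to be differentiated.
  have hxc : ContinuousOn x (Icc 0 T) := by
    have hle : ∀ s ∈ Icc 0 T, ∀ t ∈ Icc 0 T, ‖x t - x s‖ ≤ M * ‖t - s‖ := fun s hs t ht =>
      le_of_tendsto ((hx t ht).sub (hx s hs)).norm (.of_forall fun k =>
        (convex_Icc 0 T).norm_image_sub_le_of_norm_hasDerivWithin_le (hX k)
          (fun u _ => hM k _) hs ht)
    have : LipschitzOnWith M.toNNReal x (Icc 0 T) := .of_dist_le_mul fun s hs t ht => by
      rw [dist_eq_norm, dist_eq_norm, Real.coe_toNNReal _ hM0]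
      exact hle t ht s hs
    exact this.continuousOn
  intro t ht
  exact (ODE.hasDerivWithinAt_picard_Icc (f := fun _ => g) (u := univ) ⟨le_rfl, ht.1.trans ht.2⟩
    (hg.comp continuous_snd).continuousOn hxc (fun _ _ => mem_univ _) (x 0) ht).congr hint
      (hint t ht)

end Existence

section Solutions

variable {n : ℕ} {f : Eucl n → Eucl n} {α β c l T : ℝ}

theorem exists_hasDerivWithinAt_piecewiseField (hf : ContDiff ℝ 1 f) (hf0 : f 0 = 0)
    (hfne : ∀ x, x ≠ 0 → f x ≠ 0)
    (hl : 0 < l) (hdiss : ∀ x, inner ℝ (f x) (fderiv ℝ f x (f x)) ≤ -l * ‖f x‖ ^ 2)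
    (hc : 0 < c) (hα : 0 < α ∧ α < 1) (hβ : β < 0) (hT : 0 ≤ T) (x₀ : Eucl n) :
    ∃ x : ℝ → Eucl n, x 0 = x₀ ∧
      ∀ t ∈ Icc 0 T, HasDerivWithinAt x (piecewiseField f α β c (x t)) (Icc 0 T) t := by
  set M := speed α β c ‖f x₀‖
  have hM : 0 ≤ M := speed_nonneg hc (norm_nonneg _)
  set ε : ℕ → ℝ := fun k => 1 / ((k : ℝ) + 1)
  have hε : ∀ k, 0 < ε k := fun k => Nat.one_div_pos_of_nat
  have hεanti : Antitone ε := fun j k hjk => Nat.one_div_le_one_div hjk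
  have hεlim : Tendsto ε atTop (𝓝 0) := tendsto_one_div_add_atTop_nhds_zero_nat
  set F : ℕ → Eucl n → Eucl n := fun k => regularizedField f α β c (ε k) M
  have hF : ∀ k, LocallyLipschitz (F k) := fun k => locallyLipschitz_regularizedField hc hf (hε k)
  have hFM : ∀ k y, ‖F k y‖ ≤ M := fun k y => norm_regularizedField_le hc (hε k) hM y
  choose X hX0 hX using fun k => (hF k).exists_hasDerivWithinAt_Icc (hFM k) hT x₀
  have h0 : (0 : ℝ) ∈ Icc 0 T := ⟨le_rfl, hT⟩
  have hanti : ∀ k, AntitoneOn (fun t => ‖f (X k t)‖) (Icc 0 T) := fun k =>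
    antitoneOn_norm_comp hf hl hdiss (fun t => regularizedFactor_nonneg hc hM (X k t))
      (convex_Icc 0 T) (hX k)
  have hle : ∀ k, ∀ t ∈ Icc 0 T, ‖f (X k t)‖ ≤ ‖f x₀‖ := fun k t ht => by
    simpa only [hX0] using hanti k h0 ht ht.1
  have hFeq : ∀ j k, j ≤ k → ∀ t ∈ Icc 0 T, ε j ≤ ‖f (X j t)‖ →
      F k (X j t) = piecewiseField f α β c (X j t) := fun j k hjk t ht h =>
    regularizedField_eq hc hα hβ hf0 (hε k) ((hεanti hjk).trans h) (hle j t ht)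
  -- While `‖f‖ ≥ ε j`, the curve `X j` also solves the equation of every finer `F k`, so uniqueness
  -- makes the two coincide.
  have hcoh : ∀ j k, j ≤ k → ∀ t ∈ Icc 0 T, ε j ≤ ‖f (X j t)‖ → X k t = X j t := by
    intro j k hjk t ht h
    have hsub : Icc 0 t ⊆ Icc 0 T := Icc_subset_Icc_right ht.2
    refine (hF k).eqOn_Icc_of_hasDerivWithinAt (fun s hs => (hX k s (hsub hs)).mono hsub)
      (fun s hs => ?_) ((hX0 k).trans (hX0 j).symm) ⟨ht.1, le_rfl⟩
    have hs' : ε j ≤ ‖f (X j s)‖ := h.trans (hanti j (hsub hs) ht hs.2)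
    rw [hFeq j k hjk s (hsub hs) hs', ← hFeq j j le_rfl s (hsub hs) hs']
    exact (hX j s (hsub hs)).mono hsub
  have hball : ∀ k, ∀ t ∈ Icc 0 T, X k t ∈ Metric.closedBall x₀ (M * T) := fun k t ht => by
    rw [mem_closedBall_iff_norm, ← hX0 k]
    exact (norm_image_sub_le_of_norm_deriv_le_segment' (hX k) (fun s _ => hFM k _) t ht).trans
      (by gcongr; linarith [ht.2])
  have hg0 : piecewiseField f α β c 0 = 0 := by simp [piecewiseField]
  have hlim : ∀ t ∈ Icc 0 T, ∃ p, Tendsto (fun k => X k t) atTop (𝓝 p) ∧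
      Tendsto (fun k => F k (X k t)) atTop (𝓝 (piecewiseField f α β c p)) := by
    intro t ht
    -- Either some `X j` is still above its level at time `t`, and the sequence is eventually
    -- constant, or `‖f (X k t)‖ < ε k` for all `k`, and compactness of the ball forces the limit 0.
    by_cases h : ∃ j, ε j ≤ ‖f (X j t)‖
    · obtain ⟨j, hj⟩ := h
      refine ⟨X j t, tendsto_const_nhds.congr' ?_, tendsto_const_nhds.congr' ?_⟩
      · filter_upwards [eventually_ge_atTop j] with k hk using (hcoh j k hk t ht hj).symm
      · filter_upwards [eventually_ge_atTop j] with k hk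
        rw [hcoh j k hk t ht hj, hFeq j k hk t ht hj]
    · push Not at h
      refine ⟨0, (isCompact_closedBall x₀ (M * T)).tendsto_of_tendsto_comp hf.continuous
        (fun y hy => ?_) (fun k => hball k t ht) ?_, ?_⟩
      · by_contra hne
        exact hfne y hne (hy.trans hf0)
      · rw [hf0]
        exact squeeze_zero_norm (fun k => (h k).le) hεlim
      · rw [hg0]
        refine squeeze_zero_norm (fun k => norm_regularizedField_le_speed hc hα.2 hβ (hε k) hM
          (h k).le) ?_
        have := ((continuous_speed (c := c) hα.2 hβ).tendsto 0).comp hεlim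
        rwa [speed_zero hα.2 hβ] at this
  choose! x hx hgx using hlim
  refine ⟨x, tendsto_nhds_unique (hx 0 h0) ?_, hasDerivWithinAt_of_tendsto
    (fun k => (hF k).continuous) hFM
    (continuous_piecewiseField hc hα hβ hf.continuous hf0) hX hx hgx⟩
  simp_rw [hX0]
  exact tendsto_const_nhds

end Solutions

theorem gain_pos {α β : ℝ} (hα : α < 1) (hβ : β < 0) : 0 < gain α β :=
  Real.rpow_pos_of_pos (div_pos (by linarith) (by linarith)) _

/-! ### Extension to `[0, ∞)`, Lyapunov stability and the settling time. -/

section Stability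

variable {n : ℕ} {f : Eucl n → Eucl n} {α β c l : ℝ}

theorem IsSolution.hasDerivWithinAt_Icc {g : Eucl n → Eucl n} {x₀ : Eucl n} {x : ℝ → Eucl n}
    (hx : IsSolution g x₀ x) (T : ℝ) :
    ∀ t ∈ Icc 0 T, HasDerivWithinAt x (g (x t)) (Icc 0 T) t := fun t ht =>
  (hx.2 t ht.1).mono Icc_subset_Ici_self

/-- A solution on `[0, T]` that ends at an equilibrium extends by a constant. -/
theorem exists_isSolution_of_Icc {g : Eucl n → Eucl n} (hg0 : g 0 = 0) {T : ℝ} (hT : 0 ≤ T)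
    {x : ℝ → Eucl n} (hx : ∀ t ∈ Icc 0 T, HasDerivWithinAt x (g (x t)) (Icc 0 T) t)
    (hxT : x T = 0) : ∃ y, IsSolution g (x 0) y := by
  classical
  set y : ℝ → Eucl n := fun t => if t ≤ T then x t else 0
  have hyx : ∀ t ∈ Icc 0 T, y t = x t := fun t ht => if_pos ht.2
  have hy0 : ∀ t ∈ Ici T, y t = 0 := fun t ht => by
    rcases (mem_Ici.1 ht).eq_or_lt with rfl | h
    · exact (if_pos le_rfl).trans hxT
    · exact if_neg h.not_ge
  have hl : ∀ t ∈ Icc 0 T, HasDerivWithinAt y (g (y t)) (Icc 0 T) t := fun t ht =>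
    hyx t ht ▸ (hx t ht).congr hyx (hyx t ht)
  have hr : ∀ t ∈ Ici T, HasDerivWithinAt y (g (y t)) (Ici T) t := fun t ht => by
    rw [hy0 t ht, hg0]
    exact (hasDerivWithinAt_const t _ 0).congr hy0 (hy0 t ht)
  refine ⟨y, hyx 0 ⟨le_rfl, hT⟩, fun t ht => ?_⟩
  rcases lt_trichotomy t T with h | rfl | h
  · exact (hl t ⟨ht, h.le⟩).mono_of_mem_nhdsWithin
      (mem_nhdsWithin.2 ⟨Iio T, isOpen_Iio, h, fun s hs => ⟨hs.2, le_of_lt hs.1⟩⟩)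
  · have := (hl t ⟨ht, le_rfl⟩).union (hr t self_mem_Ici)
    rwa [Icc_union_Ici_eq_Ici hT] at this
  · exact (hr t h.le).mono_of_mem_nhdsWithin (mem_nhdsWithin_of_mem_nhds (Ici_mem_nhds h))

/-- To leave the ball of radius `ε` a trajectory must cross its sphere, where `‖f‖ ≥ m > 0`; this is
impossible if `‖f‖ < m` initially. -/
theorem lyapunovStable_piecewiseField (hf : ContDiff ℝ 1 f) (hf0 : f 0 = 0)
    (hfne : ∀ x, x ≠ 0 → f x ≠ 0)
    (hl : 0 < l) (hdiss : ∀ x, inner ℝ (f x) (fderiv ℝ f x (f x)) ≤ -l * ‖f x‖ ^ 2)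
    (hc : 0 < c) (hα : 0 < α) (hβ : β < 0) : LyapunovStable (piecewiseField f α β c) := by
  intro ε hε
  obtain ⟨m, hm, hmle⟩ := (isCompact_sphere (0 : Eucl n) ε).exists_forall_le'
    hf.continuous.norm.continuousOn (a := 0) fun y hy => norm_pos_iff.2 <| hfne y <| by
      rintro rfl
      simp [hε.ne] at hy
  have hcont : Tendsto (fun y => ‖f y‖) (𝓝 0) (𝓝 0) := by
    simpa [hf0] using hf.continuous.norm.tendsto 0
  obtain ⟨δ, hδ, hδm⟩ := Metric.eventually_nhds_iff.1 (hcont.eventually_lt_const hm)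
  refine ⟨min δ ε, lt_min hδ hε, fun x₀ x hx hx₀ t ht => ?_⟩
  by_contra! hge
  have hxc : ContinuousOn (fun s => ‖x s‖) (Icc 0 t) := ContinuousOn.norm fun s hs =>
    (hx.hasDerivWithinAt_Icc t s hs).continuousWithinAt
  obtain ⟨s, hs, hse⟩ := intermediate_value_Icc ht hxc
    ⟨by rw [hx.1]; exact (hx₀.trans_le (min_le_right _ _)).le, hge⟩
  have h1 := hmle (x s) (by simpa using hse)
  have h2 := antitoneOn_norm_comp_piecewiseField hf hf0 hl hdiss hc hα hβ (convex_Icc 0 t)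
    (hx.hasDerivWithinAt_Icc t) ⟨le_rfl, ht⟩ hs hs.1
  have h3 := hδm (y := x₀) (by simpa using hx₀.trans_le (min_le_left _ _))
  simp only [hx.1] at h2
  linarith

/-- The first time from which on the solution starting at `x₀` is at the origin. -/
noncomputable def settlingTime (g : Eucl n → Eucl n) (x₀ : Eucl n) : ℝ :=
  sInf {s | 0 ≤ s ∧ ∀ x, IsSolution g x₀ x → ∀ t ≥ s, x t = 0}

theorem isSettlingTime_settlingTime {g : Eucl n → Eucl n} {Tmax : ℝ} (hT : 0 ≤ Tmax)
    (h : ∀ x₀ x, IsSolution g x₀ x → ∀ t ≥ Tmax, x t = 0) :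
    IsSettlingTime g (settlingTime g) ∧ ∀ x₀, settlingTime g x₀ ≤ Tmax := by
  have hbdd : ∀ x₀, BddBelow {s | 0 ≤ s ∧ ∀ x, IsSolution g x₀ x → ∀ t ≥ s, x t = 0} :=
    fun x₀ => ⟨0, fun s hs => hs.1⟩
  have h0 : ∀ x₀, 0 ≤ settlingTime g x₀ := fun x₀ => Real.sInf_nonneg fun s hs => hs.1
  refine ⟨⟨h0, fun x₀ x hx => ?_⟩, fun x₀ => csInf_le (hbdd x₀) ⟨hT, h x₀⟩⟩
  set τ := settlingTime g x₀
  have hxc : ContinuousOn x (Ici 0) := fun s hs => (hx.2 s hs).continuousWithinAt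
  have hgt : ∀ t ∈ Ioi τ, x t = 0 := fun t ht => by
    obtain ⟨s, hs, hst⟩ := exists_lt_of_csInf_lt
      (s := {s | 0 ≤ s ∧ ∀ x, IsSolution g x₀ x → ∀ t ≥ s, x t = 0}) ⟨Tmax, hT, h x₀⟩ ht
    exact hs.2 x hx t hst.le
  -- The infimum need not be attained a priori; right continuity of `x` at `τ` settles it.
  have hτ : x τ = 0 := by
    have h1 : Tendsto x (𝓝[>] τ) (𝓝 (x τ)) :=
      (hxc τ (h0 x₀)).mono fun t ht => (h0 x₀).trans (le_of_lt ht)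
    exact tendsto_nhds_unique h1
      (tendsto_const_nhds.congr' (eventually_mem_nhdsWithin.mono fun t ht => (hgt t ht).symm))
  refine ⟨?_, fun t ht => ?_⟩
  · have := (hxc τ (h0 x₀)).tendsto
    rwa [hτ] at this
  · rcases (ge_iff_le.1 ht).eq_or_lt with rfl | hlt
    exacts [hτ, hgt t hlt]

end Stability

theorem mainTheorem4 (n : ℕ) (f : Eucl n → Eucl n) (α β : ℝ)
    (hα : 0 < α ∧ α < 1) (hβ : β < 0)
    (hf : ContDiff ℝ 1 f) (hf0 : f 0 = 0) (hfne : ∀ x, x ≠ 0 → f x ≠ 0)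
    (hgrad : IsGradientField f)
    (hV : Tendsto (lineIntegral f) (cocompact (Eucl n)) atBot)
    (hH : ConditionI (matrixH f) ∨ ConditionII f (matrixH f)) :
    HasUniqueSolutions (piecewiseField f α β (gain α β)) ∧
      FixedTimeStable (piecewiseField f α β (gain α β)) := by
  obtain ⟨l, hl, hdiss⟩ := exists_inner_fderiv_le hf0 hH
  have hc := gain_pos hα.2 hβ
  set c := gain α β
  have hg0 : piecewiseField f α β c 0 = 0 := by simp [piecewiseField]
  set Tmax := 1 / (-β * l * c) + 1 / (α * l * c)
  have hT : 0 ≤ Tmax := by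
    have := hα.1
    have : 0 < -β := neg_pos.2 hβ
    positivity
  have hsettle : ∀ {x : ℝ → Eucl n} {t : ℝ},
      (∀ s ∈ Icc 0 t, HasDerivWithinAt x (piecewiseField f α β c (x s)) (Icc 0 t) s) →
        Tmax ≤ t → x t = 0 := fun hx ht => by
    by_contra hne
    exact hfne _ hne (eq_zero_of_settling_le hf hf0 hl hdiss hc hα.1 hβ hx ht)
  obtain ⟨hset, hmax⟩ := isSettlingTime_settlingTime hT fun x₀ x hx t ht =>
    hsettle ((hx : IsSolution (piecewiseField f α β c) x₀ x).hasDerivWithinAt_Icc t) ht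
  refine ⟨fun x₀ => ⟨?_, fun x y hx hy t ht => ?_⟩, hg0,
    lyapunovStable_piecewiseField hf hf0 hfne hl hdiss hc hα.1 hβ, _, hset, Tmax, hmax⟩
  -- Existence is needed only up to `Tmax`, since the solution is at the equilibrium by then.
  · obtain ⟨x, rfl, hx⟩ :=
      exists_hasDerivWithinAt_piecewiseField hf hf0 hfne hl hdiss hc hα hβ hT x₀
    exact exists_isSolution_of_Icc hg0 hT hx (hsettle hx le_rfl)
  · exact eq_of_hasDerivWithinAt_piecewiseField hf hf0 hfne hl hdiss hc hα hβ
      (hx.hasDerivWithinAt_Icc t) (hy.hasDerivWithinAt_Icc t) (hx.1.trans hy.1.symm) ht
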